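/- **Theorem 1 (uniform coverage of the identified set).** *Setup.* Let $(X_i,W_i)$, $i=1,2,\dots$, be iid with law $P\in\mathcal P$ on $\mathbb R^{d_X}\times\mathbb R^{d_W}$; let $\Theta\subseteq\mathbb R^d$ and let $m:\mathbb R^{d_W}\times\Theta\to\mathbb R^{d_Y}$ be measurable. The identified set is $\Theta_0(P)=\{\theta\in\Theta: m(W_i,\theta)\ \text{is } P\text{-integrable and } E_P[m(W_i,\theta)\mid X_i]\ge 0\ P\text{-a.s.}\}$. Let $\mathcal G$ be a class of functions $g=(g_1,\dots,g_{d_Y})$ on $\mathbb R^{d_X}$. Write $E_n$ for the sample mean over $i\le n$, $\hat\mu_{n,j}(\theta,g)=E_n m_j(W_i,\theta)g_j(X_i)$ and $\hat\sigma_{n,j}(\theta,g)=\{E_n[m_j(W_i,\theta)g_j(X_i)]^2-[E_n m_j(W_i,\theta)g_j(X_i)]^2\}^{1/2}$. For $S:\mathbb R^{d_Y}\to\mathbb R_+$, (possibly data dependent) truncation points $\sigma_n$ and data dependent critical values $\hat c_n$, put $$T_n(\theta)=\sup_{g\in\mathcal G}S\left(\frac{\hat\mu_{n,1}(\theta,g)}{\hat\sigma_{n,1}(\theta,g)\vee\sigma_n},\dots,\frac{\hat\mu_{n,d_Y}(\theta,g)}{\hat\sigma_{n,d_Y}(\theta,g)\vee\sigma_n}\right),\qquad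 \mathcal C_n(\hat c_n)=\Big\{\theta\in\Theta:\sqrt{n/\log n}\;T_n(\theta)\le\hat c_n\Big\}.$$ *Measurability.* $\Theta$ is an analytic (e.g. Borel) set and $\mathcal G$ is permissible: $\mathcal G=\{\gamma_t:t\in\mathcal T\}$ for a standard Borel space $\mathcal T$ with $(t,x)\mapsto\gamma_t(x)$ jointly measurable. Probabilities of events that may fail to be measurable are inner probabilities. *Assumptions.* 1. $g_j(X_i)\ge 0$ $P$-a.s. for all $j$, $g\in\mathcal G$, $P\in\mathcal P$. 2. There are $A,V>0$ such that, for each $j$, the classes $\{s\,m_j(w,\theta)g_j(x)+t\}$ and $\{(s\,m_j(w,\theta)g_j(x)+t)^2\}$ of functions of $(x,w)$, indexed by $\theta\in\Theta$, $g\in\mathcal G$, $s,t\in[-(\overline Y\vee 1),\overline Y\vee 1]$, both satisfy $\sup_Q N(\varepsilon,\mathcal F,L_1(Q))\le A\varepsilon^{-V}$ for $0<\varepsilon<1$. The supremum is over all probability measures $Q$, and $N(\varepsilon,\mathcal F,L_1(Q))$ is the least number of functions in $L_1(Q)$, not necessarily in $\mathcal F$, such that every $f\in\mathcal F$ is within $L_1(Q)$-distance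 $\varepsilon$ of one of them. 3. For a fixed $\overline Y\ge 0$, $|m_j(W_i,\theta)g_j(X_i)|\le\overline Y$ $P$-a.s. for all $j$, $\theta\in\Theta$, $g\in\mathcal G$, $P\in\mathcal P$. 4. $S(t)>0$ iff $t_j<0$ for some $j$; and for some constants $K_{S,1},K_{S,2}>0$ and every $c>0$, $S(t)\ge c$ implies $t_j\le -cK_{S,1}$ for some $j$, and $S(t)\le c$ implies $t_j\ge -cK_{S,2}$ for all $j$. 5. $\sigma_n$ is bounded from above, and $\sigma_n\sqrt{n/\log n}\ge\hat a_n$ for $n\ge 2$, for some (possibly data dependent) $\hat a_n$. *Conclusion.* There is a constant $K_0$ depending only on $V$ and $\overline Y$ such that, for every $K$ with $K>K_0$ and $K\,K_{S,1}>K_0$: if $\hat a_n\ge K$ and $\hat c_n\ge K$ with probability approaching one uniformly in $P\in\mathcal P$, then $$\inf_{P\in\mathcal P}P\big(\Theta_0(P)\subseteq\mathcal C_n(\hat c_n)\big)\to 1\qquad(n\to\infty).$$ -/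

import Mathlib

open MeasureTheory ProbabilityTheory Filter Topology
open scoped ENNReal NNReal

namespace KSCoverage

/-- `ℝ^k` with its Euclidean structure. -/
abbrev E (k : ℕ) : Type := EuclideanSpace ℝ (Fin k)

/-- The space of one observation `(X_i, W_i)`. -/
abbrev Obs (dX dW : ℕ) : Type := E dX × E dW

/-! ### Covering numbers -/

/-- The `L₁(Q)` covering number: the least `k` such that there are functions
`h_1, …, h_k ∈ L₁(Q)`, not necessarily in the class `F`, for which every `f ∈ F` is at
`L₁(Q)`-distance at most `ε` from one of them (`⊤` if there is no such `k`). -/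
noncomputable def coveringNumberL1 {Z : Type*} [MeasurableSpace Z]
    (ε : ℝ) (F : Set (Z → ℝ)) (Q : Measure Z) : ℕ∞ :=
  ⨅ (k : ℕ) (_ : ∃ h : Fin k → Z → ℝ, (∀ i, MemLp (h i) 1 Q) ∧
    ∀ f ∈ F, ∃ i, eLpNorm (f - h i) 1 Q ≤ ENNReal.ofReal ε), (k : ℕ∞)

/-- `sup_Q N(ε, F, L₁(Q)) ≤ A ε^{-V}` for all `0 < ε < 1`, where `Q` ranges over all
probability measures. -/
def HasPolynomialCovering {Z : Type*} [MeasurableSpace Z]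
    (F : Set (Z → ℝ)) (A V : ℝ) : Prop :=
  ∀ ε : ℝ, 0 < ε → ε < 1 → ∀ Q : Measure Z, IsProbabilityMeasure Q →
    ((coveringNumberL1 ε F Q : ℕ∞) : ℝ≥0∞) ≤ ENNReal.ofReal (A * ε ^ (-V))

/-- The instrument class is a (Suslin) permissible class: it can be written as
`{γ t | t ∈ T}` with `T` a standard Borel space and `(t, x) ↦ γ t x` jointly measurable.
(Every Suslin index space is a measurable image of a standard Borel one.) -/
def Permissible {dX dY : ℕ} (G : Set (E dX → E dY)) : Prop :=
  ∃ (T : Type) (_ : MeasurableSpace T) (_ : StandardBorelSpace T) (γ : T → E dX → E dY),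
    Measurable (Function.uncurry γ) ∧ Set.range γ = G

/-! ### Sample and population moments -/

section Model

variable {dX dW d dY : ℕ} {Θ : Set (E d)}

/-- `m_j(W, θ) g_j(X)` as a function of the observation `z = (X, W)`. -/
def weightedMoment (m : E dW × Θ → E dY) (θ : Θ) (g : E dX → E dY) (j : Fin dY)
    (z : Obs dX dW) : ℝ :=
  m (z.2, θ) j * g z.1 j

/-- The class `{s m_j(W, θ) g_j(X) + t | θ ∈ Θ, g ∈ G, s, t ∈ [-(Ybar ∨ 1), Ybar ∨ 1]}`. -/
def classOne (m : E dW × Θ → E dY) (G : Set (E dX → E dY)) (Ybar : ℝ) (j : Fin dY) :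
    Set (Obs dX dW → ℝ) :=
  {f | ∃ θ : Θ, ∃ g ∈ G, ∃ s ∈ Set.Icc (-(max Ybar 1)) (max Ybar 1),
    ∃ t ∈ Set.Icc (-(max Ybar 1)) (max Ybar 1),
      f = fun z => s * weightedMoment m θ g j z + t}

/-- The class `{(s m_j(W, θ) g_j(X) + t)² | θ ∈ Θ, g ∈ G, s, t ∈ [-(Ybar ∨ 1), Ybar ∨ 1]}`. -/
def classTwo (m : E dW × Θ → E dY) (G : Set (E dX → E dY)) (Ybar : ℝ) (j : Fin dY) :
    Set (Obs dX dW → ℝ) :=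
  {f | ∃ θ : Θ, ∃ g ∈ G, ∃ s ∈ Set.Icc (-(max Ybar 1)) (max Ybar 1),
    ∃ t ∈ Set.Icc (-(max Ybar 1)) (max Ybar 1),
      f = fun z => (s * weightedMoment m θ g j z + t) ^ 2}

/-- The identified set `Θ₀(P) = {θ ∈ Θ | E_P[m(W, θ) | X] ≥ 0 P-a.s.}`; for the conditional
expectation to make sense, `m(W, θ)` has to be `P`-integrable. -/
def identifiedSet (m : E dW × Θ → E dY) (P : Measure (Obs dX dW)) : Set Θ :=
  {θ | ∀ j : Fin dY,
    Integrable (fun z : Obs dX dW => m (z.2, θ) j) P ∧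
    0 ≤ᵐ[P] P[fun z : Obs dX dW => m (z.2, θ) j |
      MeasurableSpace.comap (Prod.fst : Obs dX dW → E dX) inferInstance]}

/-- The sample mean `E_n f = n⁻¹ ∑_{i=1}^n f(z_i)`; the sample is `z 0, …, z (n-1)`. -/
noncomputable def sampleMean {Z : Type*} (n : ℕ) (z : ℕ → Z) (f : Z → ℝ) : ℝ :=
  (∑ i ∈ Finset.range n, f (z i)) / n

/-- The sample standard deviation `{E_n f² - (E_n f)²}^{1/2}`. -/
noncomputable def sampleSD {Z : Type*} (n : ℕ) (z : ℕ → Z) (f : Z → ℝ) : ℝ :=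
  Real.sqrt (sampleMean n z (fun x => f x ^ 2) - sampleMean n z f ^ 2)

/-- The vector with entries `μ̂_{n,j}(θ, g) / (σ̂_{n,j}(θ, g) ∨ σ)`. -/
noncomputable def studentized (m : E dW × Θ → E dY) (n : ℕ) (z : ℕ → Obs dX dW) (σ : ℝ)
    (θ : Θ) (g : E dX → E dY) : E dY :=
  WithLp.toLp 2 fun j =>
    sampleMean n z (weightedMoment m θ g j) / max (sampleSD n z (weightedMoment m θ g j)) σ

/-- The KS statistic `T_n(θ)`, a supremum over `g ∈ G` taken in `[0, ∞]`. -/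
noncomputable def ksStat (m : E dW × Θ → E dY) (G : Set (E dX → E dY)) (S : E dY → ℝ≥0)
    (n : ℕ) (z : ℕ → Obs dX dW) (σ : ℝ) (θ : Θ) : ℝ≥0∞ :=
  ⨆ g ∈ G, (S (studentized m n z σ θ g) : ℝ≥0∞)

/-- The confidence region `C_n(c) = {θ ∈ Θ | √(n / log n) T_n(θ) ≤ c}`. -/
noncomputable def confidenceRegion (m : E dW × Θ → E dY) (G : Set (E dX → E dY))
    (S : E dY → ℝ≥0) (n : ℕ) (z : ℕ → Obs dX dW) (σ c : ℝ) : Set Θ :=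
  {θ | ((ENNReal.ofReal (Real.sqrt (n / Real.log n)) * ksStat m G S n z σ θ : ℝ≥0∞) : EReal)
    ≤ (c : EReal)}

end Model

/-- The conditions on `S : ℝ^{d_Y} → ℝ₊`, with constants `K_{S,1} = KS₁` and `K_{S,2} = KS₂`. -/
def SCondition {dY : ℕ} (S : E dY → ℝ≥0) (KS₁ KS₂ : ℝ) : Prop :=
  (∀ t, 0 < S t ↔ ∃ j, t j < 0) ∧
  0 < KS₁ ∧ 0 < KS₂ ∧
  ∀ c : ℝ, 0 < c → ∀ t,
    (c ≤ (S t : ℝ) → ∃ j, t j ≤ -(c * KS₁)) ∧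
    ((S t : ℝ) ≤ c → ∀ j, -(c * KS₂) ≤ t j)

/-! ### Probability approaching one, uniformly -/

/-- Inner probability of an event that need not be measurable (for a measurable event it is
its probability). -/
noncomputable def innerProb {Ω : Type*} [MeasurableSpace Ω] (μ : Measure Ω) (s : Set Ω) :
    ℝ≥0∞ :=
  ⨆ (A : Set Ω) (_ : MeasurableSet A) (_ : A ⊆ s), μ A

/-- `inf_{P ∈ Ps} P(s_n) → 1` as `n → ∞`, where the event `s_n` may depend on `P` and `Pr P` is
the probability on the sample space when the data are drawn from `P`. -/
def UniformlyWPA1 {Ω Z : Type*} [MeasurableSpace Ω] [MeasurableSpace Z]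
    (Ps : Set (Measure Z)) (Pr : Measure Z → Measure Ω) (s : Measure Z → ℕ → Set Ω) : Prop :=
  Tendsto (fun n => ⨅ P ∈ Ps, innerProb (Pr P) (s P n)) atTop (𝓝 1)

end KSCoverage

/-! A miss of `θ` in the identified set yields `g`, `j` for which f = m_j(·,θ)g_j has nonnegative
mean, but sample mean below -κ and below -√κ times its sample standard deviation, with κ = K₀² log n
/ n. For a suitable small scale s ≥ 0 the sum of -sf - (sf)² over the sample is then at least (2V+1)
log n (`exists_scale_of_sampleMean_le`). As exp(-u-u²) ≤ 1-u for |u| ≤ 1/2, the product of the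
weights 1 - sf is at least n^(2V+1). Each weight is nonnegative with mean at most one, so for a
single f Markov's inequality bounds the probability by n^-(2V+1). No variance estimate is needed.

Uniformity over the class comes from `measure_exists_prod_ge_le`. Each observation is put in a row
with n independent copies. Under an independent uniform choice of one entry per row, the average
product is the product of the row means, so Markov's inequality becomes a count of choices
(`card_choices_le`). A cover at scale 1/(n(n+1)) changes each product on the array by at most a
constant factor, so the union bound costs about n^(2V) balls, leaving O(1/n). Rows of length n+1
matter: bounding the one unknown entry by 3/2 costs only a constant over all n rows.

Swapping entries preserves the law, but using this requires a null measurable event. The event is a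
projection of a Borel set, hence analytic, and `AnalyticSet.nullMeasurableSet` applies. -/

/-! ### Analytic sets are universally measurable -/

/-- Inner regularity of analytic sets with respect to compact sets. -/
theorem MeasureTheory.AnalyticSet.exists_isCompact_le_add {α : Type*} [TopologicalSpace α]
    [PolishSpace α] [MeasurableSpace α] [BorelSpace α] (μ : Measure α) [IsFiniteMeasure μ]
    {s : Set α} (hs : AnalyticSet s) {ε : ℝ≥0∞} (hε : ε ≠ 0) :
    ∃ K ⊆ s, IsCompact K ∧ μ s ≤ μ K + ε := by
  let := TopologicalSpace.upgradeIsCompletelyMetrizable α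
  rw [AnalyticSet] at hs
  rcases hs with rfl | ⟨f, hf, rfl⟩
  · exact ⟨∅, subset_rfl, isCompact_empty, by simp⟩
  have hε2 : ε / 2 ≠ 0 := (ENNReal.half_pos hε).ne'
  obtain ⟨δ, hδ, hδε⟩ := ENNReal.exists_pos_sum_of_countable' hε2 ℕ
  -- Bounding coordinate k by m exhausts C as m grows, so by continuity from below some m loses at
  -- most `δ k`.
  have step : ∀ (C : Set (ℕ → ℕ)) (k : ℕ), ∃ m : ℕ,
      μ (f '' C) ≤ μ (f '' (C ∩ {x | x k ≤ m})) + δ k := by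
    intro C k
    have hU : f '' C = ⋃ m : ℕ, f '' (C ∩ {x | x k ≤ m}) := by
      rw [← Set.image_iUnion, ← Set.inter_iUnion]
      congr 1
      ext x
      simp only [Set.mem_inter_iff, Set.mem_iUnion, Set.mem_ofPred_eq]
      exact ⟨fun h => ⟨h, x k, le_rfl⟩, fun h => h.1⟩
    have hmono : Monotone fun m : ℕ => f '' (C ∩ {x | x k ≤ m}) := by
      intro a b hab
      exact Set.image_mono (Set.inter_subset_inter_right _ fun x (hx : x k ≤ a) => hx.trans hab)
    have htend := tendsto_measure_iUnion_atTop (μ := μ) hmono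
    rw [← hU] at htend
    by_cases h0 : μ (f '' C) = 0
    · exact ⟨0, by simp [h0]⟩
    have hlt : μ (f '' C) - δ k < μ (f '' C) :=
      ENNReal.sub_lt_self (measure_ne_top _ _) h0 (hδ k).ne'
    obtain ⟨m, hm⟩ := (htend.eventually (lt_mem_nhds hlt)).exists
    exact ⟨m, tsub_le_iff_right.1 hm.le⟩
  choose m hm using step
  let C : ℕ → Set (ℕ → ℕ) := fun k =>
    Nat.rec Set.univ (fun k D => D ∩ {x | x k ≤ m D k}) k
  have hC1 : ∀ k, C (k + 1) = C k ∩ {x | x k ≤ m (C k) k} := fun k => rfl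
  let N : ℕ → ℕ := fun k => m (C k) k
  have hCmem : ∀ k, ∀ x ∈ C k, ∀ i < k, x i ≤ N i := by
    intro k
    induction k with
    | zero => intro x _ i hi; omega
    | succ k ih =>
      intro x hx i hi
      rw [hC1] at hx
      rcases Nat.lt_succ_iff_lt_or_eq.1 hi with h | rfl
      · exact ih x hx.1 i h
      · exact hx.2
  have hCμ : ∀ k, μ (Set.range f) ≤ μ (f '' C k) + ∑ i ∈ Finset.range k, δ i := by
    intro k
    induction k with
    | zero => simp [C]
    | succ k ih =>
      rw [Finset.sum_range_succ, hC1]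
      calc μ (Set.range f) ≤ μ (f '' C k) + ∑ i ∈ Finset.range k, δ i := ih
        _ ≤ (μ (f '' (C k ∩ {x | x k ≤ m (C k) k})) + δ k) + ∑ i ∈ Finset.range k, δ i := by
          gcongr
          exact hm _ _
        _ = _ := by ring
  let K' : Set (ℕ → ℕ) := Set.univ.pi fun i => Set.Iic (N i)
  have hK' : IsCompact K' := isCompact_univ_pi fun i => (Set.finite_Iic (N i)).isCompact
  refine ⟨f '' K', Set.image_subset_range _ _, hK'.image hf, ?_⟩
  obtain ⟨U, hKU, hUo, hU⟩ := Set.exists_isOpen_le_add (f '' K') μ hε2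
  -- `C k` bounds only the first k coordinates, so it is not compact. If no `C k` worked, take bad
  -- points x k and truncate them into `K'`. A subsequence of the truncations converges in `K'`, and
  -- the points themselves have the same limit, since truncation leaves coordinate i alone once k >
  -- i. This contradicts openness of the preimage of `U`.
  have hex : ∃ k, C k ⊆ f ⁻¹' U := by
    by_contra! hcon
    have hcon' : ∀ k, ∃ x ∈ C k, f x ∉ U := fun k => by
      obtain ⟨x, hx, hxU⟩ := Set.not_subset.1 (hcon k)
      exact ⟨x, hx, hxU⟩
    choose x hxC hxU using hcon'
    have hy : ∀ k, (fun i => min (x k i) (N i)) ∈ K' := fun k i _ => Set.mem_Iic.2 (min_le_right _ _)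
    obtain ⟨y, hyK, φ, hφ, hlim⟩ := hK'.tendsto_subseq hy
    have hlim2 : Tendsto (fun k => x (φ k)) atTop (𝓝 y) := by
      rw [tendsto_pi_nhds] at hlim ⊢
      intro i
      refine (hlim i).congr' ?_
      filter_upwards [eventually_gt_atTop i] with k hk
      exact min_eq_left (hCmem _ _ (hxC (φ k)) i (hk.trans_le (hφ.id_le k)))
    have hmem : y ∈ f ⁻¹' U := hKU ⟨y, hyK, rfl⟩
    obtain ⟨k, hk⟩ := (hlim2.eventually ((hUo.preimage hf).mem_nhds hmem)).exists
    exact hxU _ hk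
  obtain ⟨k, hk⟩ := hex
  calc μ (Set.range f) ≤ μ (f '' C k) + ∑ i ∈ Finset.range k, δ i := hCμ k
    _ ≤ μ U + ε / 2 := by
      gcongr
      · exact Set.image_subset_iff.2 hk
      · exact (ENNReal.sum_le_tsum _).trans hδε.le
    _ ≤ μ (f '' K') + ε / 2 + ε / 2 := by gcongr
    _ = μ (f '' K') + ε := by rw [add_assoc, ENNReal.add_halves]

/-- Analytic sets are measurable for the completion of every finite Borel measure. -/
theorem MeasureTheory.AnalyticSet.nullMeasurableSet {α : Type*} [TopologicalSpace α]
    [PolishSpace α] [MeasurableSpace α] [BorelSpace α] {s : Set α} (hs : AnalyticSet s)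
    (μ : Measure α) [IsFiniteMeasure μ] : NullMeasurableSet s μ := by
  have h : ∀ n : ℕ, ∃ K ⊆ s, IsCompact K ∧ μ s ≤ μ K + ((n : ℝ≥0∞) + 1)⁻¹ := fun n =>
    hs.exists_isCompact_le_add μ (by simp)
  choose K hKs hK hμ using h
  have hle : μ s ≤ μ (⋃ n, K n) := by
    have hlim : Tendsto (fun n : ℕ => μ (⋃ n, K n) + ((n : ℝ≥0∞) + 1)⁻¹) atTop
        (𝓝 (μ (⋃ n, K n) + 0)) := by
      refine tendsto_const_nhds.add ?_
      have := (tendsto_add_atTop_iff_nat 1).2 ENNReal.tendsto_inv_nat_nhds_zero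
      simpa using this
    rw [add_zero] at hlim
    refine ge_of_tendsto' hlim fun n => (hμ n).trans ?_
    gcongr
    exact Set.subset_iUnion K n
  have hmeas : MeasurableSet (⋃ n, K n) := MeasurableSet.iUnion fun n => (hK n).measurableSet
  exact ⟨_, hmeas,
    (ae_eq_of_subset_of_measure_ge (Set.iUnion_subset hKs) hle hmeas.nullMeasurableSet
      (measure_ne_top _ _)).symm⟩

/-! ### Symmetrization with a large ghost sample -/

namespace KSCoverage

section Array

variable {ι κ Z : Type*} [MeasurableSpace Z]

/-- The array with column `none` equal to the sample and the others to the ghost sample. -/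
def combine (p : (ι → Z) × (ι → κ → Z)) (q : ι × Option κ) : Z :=
  q.2.elim (p.1 q.1) (p.2 q.1)

theorem measurable_combine :
    Measurable (combine : (ι → Z) × (ι → κ → Z) → ι × Option κ → Z) := by
  rw [measurable_pi_iff]
  rintro ⟨j, _ | l⟩
  · exact (measurable_pi_apply j).comp measurable_fst
  · exact (measurable_pi_apply l).comp ((measurable_pi_apply j).comp measurable_snd)

theorem measurePreserving_combine [Fintype ι] [Fintype κ] (P : Measure Z) [IsProbabilityMeasure P] :
    MeasurePreserving (combine : (ι → Z) × (ι → κ → Z) → ι × Option κ → Z)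
      ((Measure.pi fun _ => P).prod (Measure.pi fun _ => Measure.pi fun _ => P))
      (Measure.pi fun _ => P) := by
  refine ⟨measurable_combine, (Measure.pi_eq fun s hs => ?_).symm⟩
  rw [Measure.map_apply measurable_combine (MeasurableSet.univ_pi hs)]
  have : (combine ⁻¹' Set.univ.pi s : Set ((ι → Z) × (ι → κ → Z))) =
      (Set.univ.pi fun j => s (j, none)) ×ˢ
        (Set.univ.pi fun j => Set.univ.pi fun l => s (j, some l)) := by
    ext p
    simp only [Set.mem_preimage, Set.mem_univ_pi, Set.mem_prod]
    constructor
    · exact fun h => ⟨fun j => h (j, none), fun j l => h (j, some l)⟩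
    · rintro ⟨h1, h2⟩ ⟨j, _ | l⟩
      · exact h1 j
      · exact h2 j l
  rw [this, Measure.prod_prod, Measure.pi_pi, Measure.pi_pi, Fintype.prod_prod_type]
  simp only [Measure.pi_pi, Fintype.prod_option, Finset.prod_mul_distrib]

/-- Exchangeability of iid coordinates; it is applied to the row swaps. -/
theorem measurePreserving_comp_equiv [Fintype ι] (P : Measure Z) [IsProbabilityMeasure P] (e : ι ≃ ι) :
    MeasurePreserving (fun (x : ι → Z) (q : ι) => x (e q))
      (Measure.pi fun _ => P) (Measure.pi fun _ => P) := by
  have hm : Measurable fun (x : ι → Z) (q : ι) => x (e q) :=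
    measurable_pi_iff.2 fun q => measurable_pi_apply _
  refine ⟨hm, (Measure.pi_eq fun s hs => ?_).symm⟩
  rw [Measure.map_apply hm (MeasurableSet.univ_pi hs)]
  have : ((fun (x : ι → Z) (q : ι) => x (e q)) ⁻¹' Set.univ.pi s) =
      Set.univ.pi fun q => s (e.symm q) := by
    ext x
    simp only [Set.mem_preimage, Set.mem_univ_pi]
    exact ⟨fun h q => by simpa using h (e.symm q), fun h q => by simpa using h (e q)⟩
  rw [this, Measure.pi_pi]
  exact Equiv.prod_comp e.symm fun q => P (s q)

end Array

/-- A set that is hit by a small proportion of finitely many measure preserving maps, at every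
point, has small measure. -/
theorem measure_le_of_card_le {X J : Type*} [MeasurableSpace X] [Fintype J] [Nonempty J]
    (μ : Measure X) [IsProbabilityMeasure μ] (τ : J → X → X)
    (hτ : ∀ j, MeasurePreserving (τ j) μ μ) {D : Set X} (hD : NullMeasurableSet D μ) {p : ℝ≥0∞}
    (h : ∀ x, (({j | τ j x ∈ D} : Set J).ncard : ℝ≥0∞) ≤ p * Fintype.card J) : μ D ≤ p := by
  classical
  have hcard : (Fintype.card J : ℝ≥0∞) ≠ 0 := by simp
  rw [← ENNReal.mul_le_mul_iff_left hcard (ENNReal.natCast_ne_top _)]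
  calc μ D * Fintype.card J = ∑ j : J, μ (τ j ⁻¹' D) := by
        simp [fun j => (hτ j).measure_preimage hD, mul_comm]
    _ = ∑ j : J, ∫⁻ x, (τ j ⁻¹' D).indicator 1 x ∂μ := by
        refine Finset.sum_congr rfl fun j _ => ?_
        rw [lintegral_indicator_one₀ (hD.preimage (hτ j).quasiMeasurePreserving)]
    _ = ∫⁻ x, ∑ j : J, (τ j ⁻¹' D).indicator 1 x ∂μ := by
        refine (lintegral_finsetSum' _ fun j _ => ?_).symm
        exact (aemeasurable_const (b := (1 : ℝ≥0∞))).indicator₀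
          (hD.preimage (hτ j).quasiMeasurePreserving)
    _ ≤ ∫⁻ _, p * Fintype.card J ∂μ := by
        refine lintegral_mono fun x => ?_
        refine le_trans (le_of_eq ?_) (h x)
        rw [Set.ncard_eq_toFinset_card']
        simp [Set.indicator_apply]
    _ = p * Fintype.card J := by simp

/-- If every point of `B` has a section of `D` of measure at least one half, then the outer
measure of `B` is at most twice that of `D`. -/
theorem measure_le_two_mul_prod {X Y : Type*} [MeasurableSpace X] [MeasurableSpace Y]
    (μ : Measure X) (ν : Measure Y) [IsProbabilityMeasure μ] [IsProbabilityMeasure ν]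
    {B : Set X} {D : Set (X × Y)} (h : ∀ x ∈ B, 1 / 2 ≤ ν {y | (x, y) ∈ D}) :
    μ B ≤ 2 * (μ.prod ν) D := by
  -- Neither set need be measurable; the measurable hull of D gives measurable sections at no cost
  -- in measure.
  let D' := toMeasurable (μ.prod ν) D
  have hD' : MeasurableSet D' := measurableSet_toMeasurable _ _
  have hsub : B ⊆ {x | 1 / 2 ≤ ν (Prod.mk x ⁻¹' D')} := fun x hx =>
    (h x hx).trans (measure_mono fun y hy => subset_toMeasurable _ _ hy)
  have hM := mul_meas_ge_le_lintegral (μ := μ) (measurable_measure_prodMk_left (ν := ν) hD') (1 / 2)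
  rw [← Measure.prod_apply hD', measure_toMeasurable] at hM
  calc μ B = 2 * (1 / 2 * μ B) := by
        rw [← mul_assoc, ENNReal.mul_div_cancel (by simp) (by simp), one_mul]
    _ ≤ 2 * (1 / 2 * μ {x | 1 / 2 ≤ ν (Prod.mk x ⁻¹' D')}) := by gcongr
    _ ≤ _ := by gcongr

/-- Random choice of one entry from every row of an array: the number of choices for which some
member of a class with a small cover has a large product. -/
theorem card_choices_le {I ι O : Type*} [Fintype ι] [Fintype O] (v : I → ι × O → ℝ)
    (hv : ∀ i q, 1 / 2 ≤ v i q) {k : ℕ} (h : Fin k → ι × O → ℝ)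
    (hcov : ∀ i, ∃ a, ∑ q, |v i q - h a q| ≤ 1) {T H : ℝ} (hT : 0 < T) (hH : 0 ≤ H) :
    (({J | ∃ i, ∏ j, ∑ o, v i (j, o) ≤ H ∧ T ≤ ∏ j, v i (j, J j)} : Set (ι → O)).ncard : ℝ) ≤
      k * (H * Real.exp 4 / T) := by
  classical
  -- Members of one ball are within 2 in ℓ¹ of the array. Entries are at least 1/2, so each ratio is
  -- at most exp(2|difference|), and every choice of entries gives a product ratio of at most e⁴.
  have hratio : ∀ i i' : I, ∀ a, ∑ q, |v i q - h a q| ≤ 1 → ∑ q, |v i' q - h a q| ≤ 1 →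
      ∀ J : ι → O, ∏ j, v i (j, J j) ≤ Real.exp 4 * ∏ j, v i' (j, J j) := by
    intro i i' a hi hi' J
    have h1 : ∀ q, v i q ≤ Real.exp (2 * |v i q - v i' q|) * v i' q := by
      intro q
      have hb := hv i' q
      have ha := le_abs_self (v i q - v i' q)
      have := Real.add_one_le_exp (2 * |v i q - v i' q|)
      have h0 := abs_nonneg (v i q - v i' q)
      nlinarith
    have h2 : ∑ j, |v i (j, J j) - v i' (j, J j)| ≤ 2 := by
      calc ∑ j, |v i (j, J j) - v i' (j, J j)|
          ≤ ∑ j, ∑ o, |v i (j, o) - v i' (j, o)| := by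
            refine Finset.sum_le_sum fun j _ => ?_
            exact Finset.single_le_sum (f := fun o => |v i (j, o) - v i' (j, o)|)
              (fun o _ => abs_nonneg _) (Finset.mem_univ (J j))
        _ = ∑ q : ι × O, |v i q - v i' q| := by rw [Fintype.sum_prod_type]
        _ ≤ ∑ q : ι × O, (|v i q - h a q| + |v i' q - h a q|) := by
            refine Finset.sum_le_sum fun q _ => ?_
            rw [abs_sub_comm (v i' q)]
            exact abs_sub_le _ _ _
        _ ≤ 2 := by rw [Finset.sum_add_distrib]; linarith
    calc ∏ j, v i (j, J j)
        ≤ ∏ j, (Real.exp (2 * |v i (j, J j) - v i' (j, J j)|) * v i' (j, J j)) :=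
          Finset.prod_le_prod (fun j _ => by linarith [hv i (j, J j)]) fun j _ => h1 _
      _ = Real.exp (2 * ∑ j, |v i (j, J j) - v i' (j, J j)|) * ∏ j, v i' (j, J j) := by
          rw [Finset.prod_mul_distrib, ← Real.exp_sum, Finset.mul_sum]
      _ ≤ Real.exp 4 * ∏ j, v i' (j, J j) := by
          refine mul_le_mul_of_nonneg_right (Real.exp_le_exp.2 (by linarith)) ?_
          exact Finset.prod_nonneg fun j _ => by linarith [hv i' (j, J j)]
  let R : Fin k → Set (ι → O) := fun a => {J | ∃ i, ∑ q, |v i q - h a q| ≤ 1 ∧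
    ∏ j, ∑ o, v i (j, o) ≤ H ∧ T ≤ ∏ j, v i (j, J j)}
  have hR : ∀ a, ((R a).ncard : ℝ) ≤ H * Real.exp 4 / T := by
    intro a
    -- Centres need not belong to the class, so a member of the ball obeying the row-sum bound
    -- serves as representative. Its products summed over all choices equal its product of row sums,
    -- which yields the count.
    by_cases hne : ∃ i, ∑ q, |v i q - h a q| ≤ 1 ∧ ∏ j, ∑ o, v i (j, o) ≤ H
    · obtain ⟨i', hi', hH'⟩ := hne
      have hJ : ∀ J ∈ R a, T ≤ Real.exp 4 * ∏ j, v i' (j, J j) := by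
        rintro J ⟨i, hi, -, hTJ⟩
        exact hTJ.trans (hratio i i' a hi hi' J)
      rw [le_div_iff₀ hT, Set.ncard_eq_toFinset_card', ← nsmul_eq_mul]
      calc (R a).toFinset.card • T
          ≤ ∑ J ∈ (R a).toFinset, Real.exp 4 * ∏ j, v i' (j, J j) :=
            Finset.card_nsmul_le_sum _ _ _ fun J hJ' => hJ J (by simpa using hJ')
        _ ≤ ∑ J : ι → O, Real.exp 4 * ∏ j, v i' (j, J j) := by
            refine Finset.sum_le_sum_of_subset_of_nonneg (Finset.subset_univ _) fun J _ _ => ?_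
            exact mul_nonneg (Real.exp_pos _).le
              (Finset.prod_nonneg fun j _ => by linarith [hv i' (j, J j)])
        _ = Real.exp 4 * ∏ j, ∑ o, v i' (j, o) := by
            rw [← Finset.mul_sum, Fintype.prod_sum]
        _ ≤ H * Real.exp 4 := by
            rw [mul_comm]
            exact mul_le_mul_of_nonneg_right hH' (Real.exp_pos _).le
    · have : R a = ∅ := Set.eq_empty_iff_forall_notMem.2 fun J ⟨i, h1, h2, _⟩ => hne ⟨i, h1, h2⟩
      rw [this]
      simp only [Set.ncard_empty, Nat.cast_zero]
      positivity
  have hsub : {J : ι → O | ∃ i, ∏ j, ∑ o, v i (j, o) ≤ H ∧ T ≤ ∏ j, v i (j, J j)} ⊆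
      ⋃ a, R a := by
    rintro J ⟨i, h1, h2⟩
    obtain ⟨a, ha⟩ := hcov i
    exact Set.mem_iUnion.2 ⟨a, i, ha, h1, h2⟩
  calc _ ≤ ((⋃ a, R a).ncard : ℝ) := by
        exact_mod_cast Set.ncard_le_ncard hsub (Set.toFinite _)
    _ ≤ ∑ a, ((R a).ncard : ℝ) := by
        have := Finset.card_biUnion_le (s := (Finset.univ : Finset (Fin k)))
          (t := fun a => (R a).toFinset)
        have h2 : (⋃ a, R a).ncard = (Finset.univ.biUnion fun a => (R a).toFinset).card := by
          rw [← Set.ncard_coe_finset]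
          simp
        rw [h2]
        refine (Nat.cast_le.2 this).trans (le_of_eq ?_)
        push_cast
        exact Finset.sum_congr rfl fun a _ => by rw [Set.ncard_eq_toFinset_card']
    _ ≤ ∑ _a : Fin k, H * Real.exp 4 / T := Finset.sum_le_sum fun a _ => hR a
    _ = k * (H * Real.exp 4 / T) := by simp

end KSCoverage

/-! ### Products over ghost samples and the maximal inequality -/

namespace KSCoverage

/-- The ratio of bases is 1 + 1/(2(n+1)), whose n-th power stays bounded: the price of replacing one
entry in every row by its upper bound 3/2. -/
theorem add_pow_le_exp_mul (n : ℕ) :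
    ((n : ℝ) + 3 / 2) ^ n ≤ Real.exp 1 * ((n : ℝ) + 1) ^ n := by
  have h1 : (n : ℝ) + 3 / 2 ≤ Real.exp (1 / (2 * (n + 1))) * (n + 1) := by
    have hn : (0 : ℝ) < n + 1 := by positivity
    have := mul_le_mul_of_nonneg_right (Real.add_one_le_exp (1 / (2 * ((n : ℝ) + 1)))) hn.le
    have e : (1 / (2 * ((n : ℝ) + 1)) + 1) * (n + 1) = n + 3 / 2 := by field_simp; ring
    linarith
  calc ((n : ℝ) + 3 / 2) ^ n ≤ (Real.exp (1 / (2 * (n + 1))) * (n + 1)) ^ n :=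
        pow_le_pow_left₀ (by positivity) h1 n
    _ = Real.exp (n * (1 / (2 * (n + 1)))) * ((n : ℝ) + 1) ^ n := by
        rw [mul_pow, ← Real.exp_nat_mul]
    _ ≤ _ := by
        refine mul_le_mul_of_nonneg_right (Real.exp_le_exp.2 ?_) (by positivity)
        rw [mul_one_div, div_le_one (by positivity)]
        linarith [Nat.cast_nonneg (α := ℝ) n]

/-- With probability at least one half, a product of independent nonnegative random variables is at
most twice an upper bound for its expectation. -/
theorem half_le_pi_prod_le {E : Type*} [MeasurableSpace E] (Q : Measure E) [IsProbabilityMeasure Q]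
    (n : ℕ) {f : E → ℝ} (hfm : Measurable f) (hf : Integrable f Q) (hf0 : ∀ y, 0 ≤ f y) {c : ℝ}
    (hc : 0 < c) (hfc : (∫ y, f y ∂Q) ^ n ≤ c) :
    1 / 2 ≤ (Measure.pi fun _ : Fin n => Q) {y | ∏ j, f (y j) ≤ 2 * c} := by
  have hF0 : ∀ y : Fin n → E, 0 ≤ ∏ j, f (y j) := fun y => Finset.prod_nonneg fun j _ => hf0 _
  have hFm : Measurable fun y : Fin n → E => ∏ j, f (y j) :=
    Finset.measurable_prod _ fun j _ => hfm.comp (measurable_pi_apply j)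
  have hFi : Integrable (fun y : Fin n → E => ∏ j, f (y j)) (Measure.pi fun _ : Fin n => Q) :=
    Integrable.fintype_prod (f := fun _ => f) fun _ => hf
  have hFint : ∫ y : Fin n → E, ∏ j, f (y j) ∂(Measure.pi fun _ : Fin n => Q) ≤ c := by
    rw [integral_fintype_prod_eq_prod (fun _ : Fin n => f)]
    simpa using hfc
  have hmarkov := mul_meas_ge_le_integral_of_nonneg (ae_of_all _ hF0) hFi (2 * c)
  have hhalf : (Measure.pi fun _ : Fin n => Q).real {y | 2 * c ≤ ∏ j, f (y j)} ≤ 1 / 2 := by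
    by_contra! hlt
    have := mul_lt_mul_of_pos_left hlt (by positivity : 0 < 2 * c)
    linarith
  have hcompl : (Measure.pi fun _ : Fin n => Q).real {y | ∏ j, f (y j) ≤ 2 * c} ≥ 1 / 2 := by
    have hsub : {y : Fin n → E | 2 * c < ∏ j, f (y j)} ⊆ {y | 2 * c ≤ ∏ j, f (y j)} := by
      intro y hy
      rw [Set.mem_ofPred_eq] at hy ⊢
      exact hy.le
    have h1 := (measureReal_mono (μ := Measure.pi fun _ : Fin n => Q) hsub).trans hhalf
    have h2 : {y : Fin n → E | ∏ j, f (y j) ≤ 2 * c} = {y | 2 * c < ∏ j, f (y j)}ᶜ := by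
      ext y; simp
    rw [h2, probReal_compl_eq_one_sub (measurableSet_lt measurable_const hFm)]
    linarith
  have := ENNReal.ofReal_le_ofReal hcompl
  rw [ofReal_measureReal] at this
  convert! this using 1
  rw [ENNReal.ofReal_div_of_pos (by norm_num)]
  simp

/-- With probability at least one half, the row products of a ghost sample are not much larger
than their expectation. -/
theorem half_le_ghost {Z : Type*} [MeasurableSpace Z] (P : Measure Z) [IsProbabilityMeasure P]
    (n : ℕ) {w : Z → ℝ} (hw : Measurable w) (hlo : ∀ z, 1 / 2 ≤ w z) (hhi : ∀ z, w z ≤ 3 / 2)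
    (hint : ∫ z, w z ∂P ≤ 1) :
    1 / 2 ≤ (Measure.pi fun _ : Fin n => Measure.pi fun _ : Fin n => P)
      {y | ∏ j, (∑ l, w (y j l) + 3 / 2) ≤ 2 * (Real.exp 1 * ((n : ℝ) + 1) ^ n)} := by
  have hwi : Integrable w P := Integrable.of_bound hw.aestronglyMeasurable (3 / 2)
    (ae_of_all _ fun z => by rw [Real.norm_eq_abs, abs_le]; constructor <;> linarith [hlo z, hhi z])
  have hwil : ∀ l : Fin n, Integrable (fun y : Fin n → Z => w (y l))
      (Measure.pi fun _ : Fin n => P) := fun l =>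
    (measurePreserving_eval (fun _ : Fin n => P) l).integrable_comp_of_integrable hwi
  have hrow : ∫ y : Fin n → Z, (∑ l, w (y l) + 3 / 2) ∂(Measure.pi fun _ : Fin n => P) ≤
      n + 3 / 2 := by
    rw [integral_add (integrable_finsetSum _ fun l _ => hwil l) (integrable_const _),
      integral_finsetSum _ fun l _ => hwil l]
    have : ∀ l : Fin n, ∫ y : Fin n → Z, w (y l) ∂(Measure.pi fun _ : Fin n => P) = ∫ z, w z ∂P :=
      fun l => integral_comp_eval (μ := fun _ : Fin n => P) hw.aestronglyMeasurable
    simp only [this]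
    simp
    nlinarith [Nat.cast_nonneg (α := ℝ) n]
  have hnn : ∀ y : Fin n → Z, 0 ≤ ∑ l, w (y l) + 3 / 2 := fun y => add_nonneg
    (Finset.sum_nonneg fun l _ => by linarith [hlo (y l)]) (by norm_num)
  exact half_le_pi_prod_le (Measure.pi fun _ : Fin n => P) n
    (f := fun y => ∑ l, w (y l) + 3 / 2)
    ((Finset.measurable_sum _ fun l _ => hw.comp (measurable_pi_apply l)).add_const _)
    ((integrable_finsetSum _ fun l _ => hwil l).add (integrable_const _)) hnn (by positivity)
    ((pow_le_pow_left₀ (integral_nonneg hnn) hrow n).trans (add_pow_le_exp_mul n))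

/-- Uniform maximal inequality for products: for a class of functions with values in
`[1/2, 3/2]` and mean at most one, the probability that some product over the sample exceeds `T`
is at most a constant times `N / T`, where `N` bounds covering numbers of finite arrays. -/
theorem measure_exists_prod_ge_le {I Z : Type*} [MeasurableSpace I] [StandardBorelSpace I]
    [TopologicalSpace Z] [PolishSpace Z] [MeasurableSpace Z] [BorelSpace Z]
    (P : Measure Z) [IsProbabilityMeasure P] (n : ℕ) {w : I → Z → ℝ}
    (hw : Measurable (Function.uncurry w)) (hlo : ∀ i z, 1 / 2 ≤ w i z)
    (hhi : ∀ i z, w i z ≤ 3 / 2) {T N : ℝ} (hT : 0 < T)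
    (hcov : ∀ x : Fin n × Option (Fin n) → Z, ∃ k : ℕ, (k : ℝ) ≤ N ∧ ∃ h : Fin k → Z → ℝ,
      ∀ i, ∃ a, ∑ q, |w i (x q) - h a (x q)| ≤ 1) :
    (Measure.pi fun _ : Fin n => P) {s | ∃ i, ∫ z, w i z ∂P ≤ 1 ∧ T ≤ ∏ j, w i (s j)} ≤
      ENNReal.ofReal (4 * Real.exp 5 * N / T) := by
  classical
  have hwi : ∀ i, Measurable (w i) := fun i => hw.comp measurable_prodMk_left
  set c : ℝ := 2 * (Real.exp 1 * ((n : ℝ) + 1) ^ n) with hc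
  let D₀ : Set (I × (Fin n × Option (Fin n) → Z)) := {p | ∫ z, w p.1 z ∂P ≤ 1 ∧
    T ≤ ∏ j, w p.1 (p.2 (j, none)) ∧ ∏ j, (∑ l, w p.1 (p.2 (j, some l)) + 3 / 2) ≤ c}
  let D : Set (Fin n × Option (Fin n) → Z) := Prod.snd '' D₀
  have hev : ∀ q, Measurable fun p : I × (Fin n × Option (Fin n) → Z) => w p.1 (p.2 q) :=
    fun q => hw.comp (measurable_fst.prodMk ((measurable_pi_apply q).comp measurable_snd))
  have hD₀ : MeasurableSet D₀ := by
    have hint : Measurable fun i => ∫ z, w i z ∂P :=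
      (StronglyMeasurable.integral_prod_right (f := w) hw.stronglyMeasurable).measurable
    have h1 : Measurable fun p : I × (Fin n × Option (Fin n) → Z) => ∏ j, w p.1 (p.2 (j, none)) :=
      Finset.measurable_prod _ fun j _ => hev _
    have h2 : Measurable fun p : I × (Fin n × Option (Fin n) → Z) =>
        ∏ j, (∑ l, w p.1 (p.2 (j, some l)) + 3 / 2) :=
      Finset.measurable_prod _ fun j _ => (Finset.measurable_sum _ fun l _ => hev _).add_const _
    exact ((measurableSet_le (hint.comp measurable_fst) measurable_const).inter
      ((measurableSet_le measurable_const h1).inter (measurableSet_le h2 measurable_const)))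
  have hDa : AnalyticSet D := hD₀.analyticSet_image measurable_snd
  have hDn : NullMeasurableSet D (Measure.pi fun _ : Fin n × Option (Fin n) => P) :=
    hDa.nullMeasurableSet _
  have hDp : (Measure.pi fun _ : Fin n × Option (Fin n) => P) D ≤
      ENNReal.ofReal (2 * Real.exp 5 * N / T) := by
    -- In row j, exchange the sample entry with the entry chosen by J.
    let e : (Fin n → Option (Fin n)) → (Fin n × Option (Fin n)) ≃ (Fin n × Option (Fin n)) :=
      fun J => Equiv.prodShear (Equiv.refl _) fun j => Equiv.swap none (J j)
    refine measure_le_of_card_le (J := Fin n → Option (Fin n)) _ (fun J x q => x (e J q))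
      (fun J => measurePreserving_comp_equiv P (e J)) hDn fun x => ?_
    obtain ⟨k, hkN, h, hh⟩ := hcov x
    have hcount := card_choices_le (fun i q => w i (x q)) (fun i q => hlo i _)
      (fun a q => h a (x q)) hh hT (H := c) (by positivity)
    have hsub : {J | (fun q => x (e J q)) ∈ D} ⊆
        {J : Fin n → Option (Fin n) | ∃ i, ∏ j, ∑ o, w i (x (j, o)) ≤ c ∧
          T ≤ ∏ j, w i (x (j, J j))} := by
      rintro J ⟨⟨i, y⟩, ⟨-, h2, h3⟩, hy⟩
      simp only at hy h2 h3
      subst hy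
      refine ⟨i, le_trans ?_ h3, by simpa [e] using h2⟩
      -- A full row sum is invariant under the swap. It is the ghost sum plus the entry now in the
      -- sample column, and that entry is at most 3/2; so the constraint on row sums no longer
      -- depends on J.
      refine Finset.prod_le_prod
        (fun j _ => Finset.sum_nonneg fun o _ => by linarith [hlo i (x (j, o))]) fun j _ => ?_
      rw [← Equiv.sum_comp (Equiv.swap none (J j)), Fintype.sum_option, add_comm]
      exact add_le_add le_rfl (hhi _ _)
    have hreal : (({J | (fun q => x (e J q)) ∈ D} : Set (Fin n → Option (Fin n))).ncard : ℝ) ≤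
        (2 * Real.exp 5 * N / T) * Fintype.card (Fin n → Option (Fin n)) := by
      calc _ ≤ (k : ℝ) * (c * Real.exp 4 / T) :=
            (Nat.cast_le.2 (Set.ncard_le_ncard hsub (Set.toFinite _))).trans hcount
        _ ≤ N * (c * Real.exp 4 / T) := by gcongr
        _ = _ := by
            rw [hc, show (5 : ℝ) = 1 + 4 by norm_num, Real.exp_add]
            simp
            ring
    have := ENNReal.ofReal_le_ofReal hreal
    rwa [ENNReal.ofReal_natCast, ENNReal.ofReal_mul' (by positivity), ENNReal.ofReal_natCast]
      at this
  have hpre : (combine ⁻¹' D : Set ((Fin n → Z) × (Fin n → Fin n → Z))) = {p | ∃ i,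
      ∫ z, w i z ∂P ≤ 1 ∧ T ≤ ∏ j, w i (p.1 j) ∧ ∏ j, (∑ l, w i (p.2 j l) + 3 / 2) ≤ c} := by
    ext p
    constructor
    · rintro ⟨⟨i, y⟩, hy, rfl⟩
      exact ⟨i, hy⟩
    · rintro ⟨i, hi⟩
      exact ⟨⟨i, combine p⟩, hi, rfl⟩
  refine (measure_le_two_mul_prod _ (Measure.pi fun _ : Fin n => Measure.pi fun _ : Fin n => P)
    (D := combine ⁻¹' D) ?_).trans ?_
  · rintro s ⟨i, hi, hTs⟩
    refine (half_le_ghost P n (hwi i) (hlo i) (hhi i) hi).trans (measure_mono fun y hy => ?_)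
    show (s, y) ∈ combine ⁻¹' D
    rw [hpre]
    exact ⟨i, hi, hTs, hy⟩
  · rw [(measurePreserving_combine P).measure_preimage hDn]
    calc _ ≤ 2 * ENNReal.ofReal (2 * Real.exp 5 * N / T) := by gcongr
      _ = ENNReal.ofReal (2 * (2 * Real.exp 5 * N / T)) := by
        rw [ENNReal.ofReal_mul (by norm_num)]; simp
      _ = _ := by ring_nf

end KSCoverage

namespace KSCoverage

/-! ### Covers of finite samples -/

theorem exists_eq_coveringNumberL1 {Z : Type*} [MeasurableSpace Z] {ε : ℝ} {F : Set (Z → ℝ)}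
    {Q : Measure Z} (hfin : coveringNumberL1 ε F Q ≠ ⊤) :
    ∃ k : ℕ, (k : ℕ∞) = coveringNumberL1 ε F Q ∧ ∃ h : Fin k → Z → ℝ,
      ∀ f ∈ F, ∃ i, eLpNorm (f - h i) 1 Q ≤ ENNReal.ofReal ε := by
  obtain ⟨k, hk⟩ := ciInf_mem fun k : ℕ =>
    ⨅ _ : ∃ h : Fin k → Z → ℝ, (∀ i, MemLp (h i) 1 Q) ∧
      ∀ f ∈ F, ∃ i, eLpNorm (f - h i) 1 Q ≤ ENNReal.ofReal ε, (k : ℕ∞)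
  change _ = coveringNumberL1 ε F Q at hk
  by_cases hp : ∃ h : Fin k → Z → ℝ, (∀ i, MemLp (h i) 1 Q) ∧
      ∀ f ∈ F, ∃ i, eLpNorm (f - h i) 1 Q ≤ ENNReal.ofReal ε
  · refine ⟨k, ?_, hp.imp fun h hh => hh.2⟩
    rw [← hk]
    simp [hp]
  · exact absurd (by rw [← hk]; simp [hp]) hfin

/-- A polynomial bound on uniform covering numbers bounds the covers of finite samples. -/
theorem HasPolynomialCovering.exists_finite_cover {Z : Type*} [MeasurableSpace Z]
    [MeasurableSingletonClass Z] {F : Set (Z → ℝ)} {A V : ℝ} (hF : HasPolynomialCovering F A V)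
    (hA : 0 ≤ A) {ι : Type*} [Fintype ι] [Nonempty ι] (x : ι → Z) {ε : ℝ} (hε : 0 < ε)
    (hε1 : ε < 1) :
    ∃ k : ℕ, (k : ℝ) ≤ A * ε ^ (-V) ∧ ∃ h : Fin k → Z → ℝ, ∀ f ∈ F, ∃ a,
      ∑ q, |f (x q) - h a (x q)| ≤ ε * Fintype.card ι := by
  have hc0 : (Fintype.card ι : ℝ≥0∞) ≠ 0 := by simp
  have hct : (Fintype.card ι : ℝ≥0∞) ≠ ⊤ := ENNReal.natCast_ne_top _
  -- The empirical measure of the points, with multiplicity, turns the L₁ distance into an average.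
  let Q : Measure Z := (Fintype.card ι : ℝ≥0∞)⁻¹ • ∑ q, Measure.dirac (x q)
  have hQ : IsProbabilityMeasure Q := ⟨by
    simp only [Q, Measure.smul_apply, Measure.finsetSum_apply, measure_univ, Finset.sum_const,
      Finset.card_univ, nsmul_eq_mul, mul_one, smul_eq_mul]
    exact ENNReal.inv_mul_cancel hc0 hct⟩
  have hle := hF ε hε hε1 Q hQ
  have hfin : coveringNumberL1 ε F Q ≠ ⊤ := by
    intro htop
    rw [htop] at hle
    exact absurd hle (by simp)
  obtain ⟨k, hk, h, hh⟩ := exists_eq_coveringNumberL1 hfin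
  rw [← hk] at hle
  refine ⟨k, ?_, h, fun f hf => ?_⟩
  · have h0 : 0 ≤ A * ε ^ (-V) := mul_nonneg hA (Real.rpow_nonneg hε.le _)
    simp only [ENat.toENNReal_coe] at hle
    rw [← ENNReal.ofReal_natCast] at hle
    exact (ENNReal.ofReal_le_ofReal_iff h0).1 hle
  · obtain ⟨a, ha⟩ := hh f hf
    refine ⟨a, ?_⟩
    rw [eLpNorm_one_eq_lintegral_enorm, lintegral_smul_measure, lintegral_finsetSum_measure]
      at ha
    simp only [lintegral_dirac, smul_eq_mul, Pi.sub_apply, Real.enorm_eq_ofReal_abs] at ha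
    rw [← ENNReal.ofReal_sum_of_nonneg fun _ _ => abs_nonneg _, mul_comm, ← div_eq_mul_inv,
      ENNReal.div_le_iff hc0 hct, ← ENNReal.ofReal_natCast, ← ENNReal.ofReal_mul hε.le] at ha
    exact (ENNReal.ofReal_le_ofReal_iff (by positivity)).1 ha

/-! ### The truncated weight `1 - u` -/

/-- `1 - u`, with `u` truncated to `[-1/2, 1/2]`. -/
noncomputable def clipWeight (u : ℝ) : ℝ := 1 - max (-(1 / 2)) (min u (1 / 2))

theorem continuous_clipWeight : Continuous clipWeight := by
  unfold clipWeight
  fun_prop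

theorem half_le_clipWeight (u : ℝ) : 1 / 2 ≤ clipWeight u := by
  have : max (-(1 / 2)) (min u (1 / 2)) ≤ 1 / 2 := max_le (by norm_num) (min_le_right _ _)
  unfold clipWeight
  linarith

theorem clipWeight_le (u : ℝ) : clipWeight u ≤ 3 / 2 := by
  have : -(1 / 2) ≤ max (-(1 / 2)) (min u (1 / 2)) := le_max_left _ _
  unfold clipWeight
  linarith

theorem clipWeight_of_abs_le {u : ℝ} (hu : |u| ≤ 1 / 2) : clipWeight u = 1 - u := by
  rw [abs_le] at hu
  rw [clipWeight, min_eq_left hu.2, max_eq_right hu.1]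

theorem abs_clipWeight_sub_le (u v : ℝ) : |clipWeight u - clipWeight v| ≤ |u - v| := by
  unfold clipWeight
  rw [sub_sub_sub_cancel_left, abs_sub_comm u v]
  refine (abs_max_sub_max_le_max _ _ _ _).trans ?_
  rw [sub_self, abs_zero, max_eq_right (abs_nonneg _)]
  refine (abs_min_sub_min_le_max _ _ _ _).trans ?_
  rw [sub_self, abs_zero, max_eq_left (abs_nonneg _)]

theorem exp_neg_sub_sq_le {u : ℝ} (hu : |u| ≤ 1 / 2) : Real.exp (-u - u ^ 2) ≤ 1 - u := by
  rw [abs_le] at hu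
  have hpos := Real.exp_pos (u + u ^ 2)
  have key : 1 ≤ (1 - u) * Real.exp (u + u ^ 2) := by
    rcases le_total u 0 with h | h
    · have := Real.add_one_le_exp (u + u ^ 2)
      have h3 : 0 ≤ -u ^ 3 := by nlinarith [sq_nonneg u, mul_nonneg (sq_nonneg u) (neg_nonneg.2 h)]
      nlinarith
    · have h1 := Real.quadratic_le_exp_of_nonneg (x := u + u ^ 2) (by positivity)
      have h2 : 1 ≤ (1 - u) * (1 + (u + u ^ 2) + (u + u ^ 2) ^ 2 / 2) := by
        have e : (1 - u) * (1 + (u + u ^ 2) + (u + u ^ 2) ^ 2 / 2) - 1 =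
          u ^ 2 * (1 - u - u ^ 2 - u ^ 3) / 2 := by ring
        have h4 : 0 ≤ 1 - u - u ^ 2 - u ^ 3 := by
          have h5 : u ^ 2 ≤ 1 / 4 := by nlinarith
          have h6 : u ^ 3 ≤ 1 / 8 := by nlinarith
          linarith
        have : 0 ≤ u ^ 2 * (1 - u - u ^ 2 - u ^ 3) / 2 := by positivity
        linarith
      exact h2.trans (mul_le_mul_of_nonneg_left h1 (by linarith))
  have e : Real.exp (-u - u ^ 2) = (Real.exp (u + u ^ 2))⁻¹ := by
    rw [← Real.exp_neg]; ring_nf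
  rw [e, inv_le_iff_one_le_mul₀ hpos]
  exact key

/-- Truncation makes the bound valid for every u. The almost sure bound on moments is then not
needed at the sample points, where its null sets would form an uncountable union over `θ` and `g`.
-/
theorem exp_le_clipWeight (u : ℝ) : Real.exp (-u - u ^ 2) ≤ clipWeight u := by
  rcases le_total |u| (1 / 2) with h | h
  · rw [clipWeight_of_abs_le h]
    exact exp_neg_sub_sq_le h
  · rcases le_abs.1 h with h | h
    · have := exp_neg_sub_sq_le (u := 1 / 2) (by norm_num)
      refine le_trans (Real.exp_le_exp.2 ?_) (this.trans ((by norm_num : (1 : ℝ) - 1 / 2 ≤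
        1 / 2).trans (half_le_clipWeight u)))
      nlinarith
    · have := exp_neg_sub_sq_le (u := -(1 / 2)) (by norm_num)
      have e : clipWeight u = 3 / 2 := by
        rw [clipWeight, min_eq_left (by linarith), max_eq_left (by linarith)]
        norm_num
      rw [e]
      refine le_trans (Real.exp_le_exp.2 ?_) (this.trans (by norm_num))
      nlinarith [sq_nonneg (u + 1 / 2)]

/-! ### Moments and samples -/

section Model

variable {dX dW d dY : ℕ} {Θ : Set (E d)}

/-- Weighted moments are nonnegative on the identified set. -/
theorem integral_weightedMoment_nonneg {m : E dW × Θ → E dY}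
    {P : Measure (Obs dX dW)} [IsProbabilityMeasure P] {θ : Θ} (hθ : θ ∈ identifiedSet m P)
    {g : E dX → E dY} (hg : Measurable g) (j : Fin dY) (hg0 : ∀ᵐ z ∂P, 0 ≤ g z.1 j)
    (hint : Integrable (weightedMoment m θ g j) P) : 0 ≤ ∫ z, weightedMoment m θ g j z ∂P := by
  obtain ⟨hmi, hcond⟩ := hθ j
  have hle : MeasurableSpace.comap (Prod.fst : Obs dX dW → E dX) inferInstance ≤
      (inferInstance : MeasurableSpace (Obs dX dW)) := measurable_fst.comap_le
  have hgj : Measurable fun x : E dX => g x j := by fun_prop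
  have hgm : StronglyMeasurable[MeasurableSpace.comap (Prod.fst : Obs dX dW → E dX) inferInstance]
      fun z : Obs dX dW => g z.1 j :=
    (hgj.comp (comap_measurable (Prod.fst : Obs dX dW → E dX))).stronglyMeasurable
  have hpull := condExp_mul_of_stronglyMeasurable_right (f := fun z : Obs dX dW => m (z.2, θ) j)
    hgm hint hmi
  have heq := integral_condExp hle (μ := P) (f := weightedMoment m θ g j)
  rw [← heq]
  refine integral_nonneg_of_ae ?_
  filter_upwards [hpull, hcond, hg0] with z h1 h2 h3
  have : P[weightedMoment m θ g j |
      MeasurableSpace.comap (Prod.fst : Obs dX dW → E dX) inferInstance] z = _ := h1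
  rw [this]
  exact mul_nonneg h2 h3

/-- If the sample mean is far below zero in units of the sample standard deviation, then for a
suitable scale the self-normalized sum is large. -/
theorem exists_scale_of_sampleMean_le {Z : Type*} {n : ℕ} (hn : 0 < n) (z : ℕ → Z) (f : Z → ℝ)
    {κ β : ℝ} (hκ : 0 < κ) (hκ1 : κ ≤ 1 / 2) (hβ : 0 < β) (hβ1 : β ≤ 1 / 2)
    (h1 : sampleMean n z f ≤ -κ) (h2 : sampleMean n z f ≤ -(Real.sqrt κ * sampleSD n z f)) :
    ∃ s ∈ Set.Icc 0 β, β * κ / 4 * n ≤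
      ∑ i ∈ Finset.range n, (-(s * f (z i)) - (s * f (z i)) ^ 2) := by
  have hn' : (0 : ℝ) < n := by exact_mod_cast hn
  obtain ⟨r, hr⟩ : ∃ r, r = -sampleMean n z f := ⟨_, rfl⟩
  have hrκ : κ ≤ r := by linarith
  have hr0 : 0 < r := by linarith
  have hS1 : ∑ i ∈ Finset.range n, f (z i) = -(n * r) := by
    rw [hr, sampleMean]; field_simp
  obtain ⟨q, hq⟩ : ∃ q, q = sampleMean n z fun x => f x ^ 2 := ⟨_, rfl⟩
  have hS2 : ∑ i ∈ Finset.range n, f (z i) ^ 2 = n * q := by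
    rw [hq, sampleMean]; field_simp
  have hsd : κ * (q - r ^ 2) ≤ r ^ 2 := by
    have h3 : q - r ^ 2 ≤ sampleSD n z f ^ 2 := by
      rw [sampleSD, ← hq, hr, neg_sq]
      rcases le_total 0 (q - sampleMean n z f ^ 2) with h | h
      · rw [Real.sq_sqrt h]
      · exact h.trans (sq_nonneg _)
    have h5 : Real.sqrt κ * sampleSD n z f ≤ r := by rw [hr]; exact le_neg_of_le_neg h2
    have h4 : (Real.sqrt κ * sampleSD n z f) ^ 2 ≤ r ^ 2 :=
      pow_le_pow_left₀ (mul_nonneg (Real.sqrt_nonneg _) (Real.sqrt_nonneg _)) h5 2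
    rw [mul_pow, Real.sq_sqrt hκ.le] at h4
    nlinarith
  -- This scale makes the linear term average exactly κβ. The second moment q satisfies κq ≤
  -- (1+κ)r², so the quadratic term averages at most β²κ(1+κ) ≤ (3/4)βκ.
  refine ⟨κ * β / r, ⟨by positivity, ?_⟩, ?_⟩
  · rw [div_le_iff₀ hr0]; nlinarith
  · have e : ∑ i ∈ Finset.range n, (-(κ * β / r * f (z i)) - (κ * β / r * f (z i)) ^ 2) =
        n * (κ * β - (κ * β / r) ^ 2 * q) := by
      simp only [mul_pow, Finset.sum_sub_distrib, Finset.sum_neg_distrib, ← Finset.mul_sum, hS1,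
        hS2]
      field_simp
    rw [e, mul_comm]
    refine mul_le_mul_of_nonneg_left ?_ hn'.le
    have h5 : (κ * β / r) ^ 2 * q ≤ β ^ 2 * κ * (1 + κ) := by
      have e2 : (κ * β / r) ^ 2 * q = β ^ 2 * κ * (κ * q) / r ^ 2 := by field_simp
      rw [e2, div_le_iff₀ (by positivity)]
      have : κ * q ≤ (1 + κ) * r ^ 2 := by nlinarith
      have h0 : 0 ≤ β ^ 2 * κ := by positivity
      nlinarith
    have h6 : β ^ 2 * κ * (1 + κ) ≤ β * κ * (3 / 4) := by
      have h0 : 0 ≤ β * κ := by positivity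
      have h7 : β * (1 + κ) ≤ 3 / 4 := by nlinarith
      nlinarith
    linarith

/-- If `θ` is missed by the confidence region, then some studentized sample moment is far below
zero. -/
theorem exists_sampleMean_le_of_notMem {m : E dW × Θ → E dY} {G : Set (E dX → E dY)}
    {S : E dY → ℝ≥0} {KS₁ KS₂ : ℝ} (hS : SCondition S KS₁ KS₂) {n : ℕ} (hn : 2 ≤ n)
    {z : ℕ → Obs dX dW} {σ c K₀ K : ℝ} (hK₀ : 0 < K₀) (hK : K₀ < K) (hKS : K₀ < K * KS₁)
    (hσ : K ≤ σ * Real.sqrt (n / Real.log n)) (hc : K ≤ c) {θ : Θ}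
    (hθ : θ ∉ confidenceRegion m G S n z σ c) :
    ∃ g ∈ G, ∃ j, sampleMean n z (weightedMoment m θ g j) ≤ -(K₀ ^ 2 * (Real.log n / n)) ∧
      sampleMean n z (weightedMoment m θ g j) ≤
        -(Real.sqrt (K₀ ^ 2 * (Real.log n / n)) * sampleSD n z (weightedMoment m θ g j)) := by
  have hn1 : (1 : ℝ) < n := by exact_mod_cast hn
  have hlog : 0 < Real.log n := Real.log_pos hn1
  obtain ⟨ρ, hρ⟩ : ∃ ρ, ρ = Real.sqrt (n / Real.log n) := ⟨_, rfl⟩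
  have hρ0 : 0 < ρ := by rw [hρ]; exact Real.sqrt_pos.2 (by positivity)
  have hL : Real.log n / n = (1 / ρ) ^ 2 := by
    rw [one_div, inv_pow, hρ, Real.sq_sqrt (by positivity), inv_div]
  obtain ⟨g, hg, hlt⟩ : ∃ g ∈ G, K < ρ * (S (studentized m n z σ θ g) : ℝ) := by
    by_contra! hcon
    refine hθ ?_
    have h1 : ENNReal.ofReal ρ * ksStat m G S n z σ θ ≤ ENNReal.ofReal K := by
      rw [ksStat, ENNReal.mul_iSup]
      refine iSup_le fun g => ?_
      rw [ENNReal.mul_iSup]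
      refine iSup_le fun hg => ?_
      rw [← ENNReal.ofReal_coe_nnreal, ← ENNReal.ofReal_mul hρ0.le]
      exact ENNReal.ofReal_le_ofReal (hcon g hg)
    show ((ENNReal.ofReal (Real.sqrt (n / Real.log n)) * ksStat m G S n z σ θ : ℝ≥0∞) : EReal) ≤ c
    rw [← hρ]
    calc ((ENNReal.ofReal ρ * ksStat m G S n z σ θ : ℝ≥0∞) : EReal)
        ≤ ((ENNReal.ofReal K : ℝ≥0∞) : EReal) := EReal.coe_ennreal_le_coe_ennreal_iff.2 h1
      _ = (K : EReal) := by rw [EReal.coe_ennreal_ofReal, max_eq_left (by linarith)]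
      _ ≤ (c : EReal) := EReal.coe_le_coe_iff.2 hc
  obtain ⟨-, hKS₁, -, hS'⟩ := hS
  obtain ⟨j, hj⟩ := (hS' (K / ρ) (div_pos (hK₀.trans hK) hρ0) (studentized m n z σ θ g)).1
    (by rw [div_le_iff₀ hρ0]; linarith)
  refine ⟨g, hg, j, ?_⟩
  set f := weightedMoment m θ g j
  have hj' : sampleMean n z f / max (sampleSD n z f) σ ≤ -(K / ρ * KS₁) := hj
  rw [← hρ] at hσ
  have hσ' : K₀ / ρ ≤ σ := by rw [div_le_iff₀ hρ0]; linarith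
  have hmax : K₀ / ρ ≤ max (sampleSD n z f) σ := hσ'.trans (le_max_right _ _)
  have hq0 : 0 < K₀ / ρ := by positivity
  rw [div_le_iff₀ (hq0.trans_le hmax)] at hj'
  have hj2 : sampleMean n z f ≤ -(K₀ / ρ * max (sampleSD n z f) σ) := by
    refine hj'.trans ?_
    rw [neg_mul, neg_le_neg_iff]
    refine mul_le_mul_of_nonneg_right ?_ (hq0.le.trans hmax)
    rw [div_mul_eq_mul_div]
    gcongr
  have hsq : K₀ ^ 2 * (Real.log n / n) = (K₀ / ρ) ^ 2 := by rw [hL]; ring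
  rw [hsq, Real.sqrt_sq hq0.le]
  constructor
  · refine hj2.trans ?_
    rw [neg_le_neg_iff, sq]
    gcongr
  · refine hj2.trans ?_
    rw [neg_le_neg_iff]
    gcongr
    exact le_max_left _ _

end Model

end KSCoverage

/-! ### Deviation bound for the class of weighted moments -/

namespace KSCoverage

section Model

variable {dX dW d dY : ℕ} {Θ : Set (E d)}

/-- A cover of the class of scaled weighted moments covers their truncated weights. -/
theorem exists_cover_clipWeight {m : E dW × Θ → E dY} {G : Set (E dX → E dY)} {Ybar A V β : ℝ}
    {j : Fin dY} (hcov : HasPolynomialCovering (classOne (dX := dX) m G Ybar j) A V) (hA : 0 < A)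
    (hβ1 : β ≤ 1) {n : ℕ} (hn : 2 ≤ n) (x : Fin n × Option (Fin n) → Obs dX dW) :
    ∃ k : ℕ, (k : ℝ) ≤ A * ((n : ℝ) * (n + 1)) ^ V ∧ ∃ h : Fin k → Obs dX dW → ℝ,
      ∀ θ : Θ, ∀ g ∈ G, ∀ s ∈ Set.Icc 0 β, ∃ a,
        ∑ q, |clipWeight (s * weightedMoment m θ g j (x q)) - h a (x q)| ≤ 1 := by
  have hn0 : 0 < n := by omega
  have : Nonempty (Fin n × Option (Fin n)) := ⟨(⟨0, hn0⟩, none)⟩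
  have hcard : (Fintype.card (Fin n × Option (Fin n)) : ℝ) = (n : ℝ) * (n + 1) := by simp
  have hN : (1 : ℝ) < (n : ℝ) * (n + 1) := by
    have : (2 : ℝ) ≤ n := by exact_mod_cast hn
    nlinarith
  obtain ⟨k, hk, h, hh⟩ := hcov.exists_finite_cover hA.le x
    (ε := ((n : ℝ) * (n + 1))⁻¹) (by positivity) (inv_lt_one_of_one_lt₀ hN)
  refine ⟨k, ?_, fun a z => clipWeight (h a z), fun θ g hg s hs => ?_⟩
  · rwa [Real.inv_rpow (by positivity), Real.rpow_neg (by positivity), inv_inv] at hk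
  · have hmem : (fun z => s * weightedMoment m θ g j z + 0) ∈ classOne (dX := dX) m G Ybar j := by
      have h1 : (1 : ℝ) ≤ max Ybar 1 := le_max_right _ _
      exact ⟨θ, g, hg, s, ⟨by linarith [hs.1], by linarith [hs.2]⟩, 0,
        ⟨by linarith, by linarith⟩, rfl⟩
    obtain ⟨a, ha⟩ := hh _ hmem
    rw [hcard, inv_mul_cancel₀ (by positivity)] at ha
    refine ⟨a, (Finset.sum_le_sum fun q _ => ?_).trans ha⟩
    rw [add_zero]
    exact abs_clipWeight_sub_le _ _

/-- The probability that, for some weighted moment with nonnegative mean, a scaled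
self-normalized sum is large. -/
theorem measure_exists_scale_le (hΘ : AnalyticSet Θ) {m : E dW × Θ → E dY} (hm : Measurable m)
    {G : Set (E dX → E dY)} (hG : Permissible G) {P : Measure (Obs dX dW)} [IsProbabilityMeasure P]
    {Ybar A V β : ℝ} {j : Fin dY}
    (hcov : HasPolynomialCovering (classOne (dX := dX) m G Ybar j) A V) (hA : 0 < A)
    (hbd : ∀ θ : Θ, ∀ g ∈ G, ∀ᵐ z ∂P, |weightedMoment m θ g j z| ≤ Ybar)
    (hβ1 : β ≤ 1) (hβY : β * Ybar ≤ 1 / 2) {n : ℕ} (hn : 2 ≤ n) (τ : ℝ) :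
    (Measure.pi fun _ : Fin n => P) {x | ∃ θ : Θ, ∃ g ∈ G, ∃ s ∈ Set.Icc 0 β,
        0 ≤ ∫ z, weightedMoment m θ g j z ∂P ∧
        τ ≤ ∑ i, (-(s * weightedMoment m θ g j (x i)) -
          (s * weightedMoment m θ g j (x i)) ^ 2)} ≤
      ENNReal.ofReal (4 * Real.exp 5 * (A * ((n : ℝ) * (n + 1)) ^ V) / Real.exp τ) := by
  obtain ⟨T, _, _, γ, hγ, rfl⟩ := hG
  rw [AnalyticSet] at hΘ
  rcases hΘ with rfl | ⟨f, hf, hfr⟩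
  · refine le_of_eq_of_le ?_ zero_le
    convert measure_empty
    · ext x
      simp
    · infer_instance
  have hfmem : ∀ a, f a ∈ Θ := fun a => by rw [← hfr]; exact ⟨a, rfl⟩
  -- `Θ` is only analytic; indexing by Baire space, of which it is a continuous image, gives a
  -- standard Borel index set.
  let ϑ : (ℕ → ℕ) → Θ := fun a => ⟨f a, hfmem a⟩
  have hϑ : Measurable ϑ := hf.measurable.subtype_mk
  have : StandardBorelSpace (Set.Icc 0 β) := measurableSet_Icc.standardBorel
  let φ : (ℕ → ℕ) × T × Set.Icc 0 β → Obs dX dW → ℝ := fun i z =>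
    (i.2.2 : ℝ) * weightedMoment m (ϑ i.1) (γ i.2.1) j z
  have hφ : Measurable (Function.uncurry φ) := by
    have h1 : Measurable fun p : ((ℕ → ℕ) × T × Set.Icc 0 β) × Obs dX dW =>
        m (p.2.2, ϑ p.1.1) := hm.comp
      ((measurable_snd.comp measurable_snd).prodMk
        (hϑ.comp (measurable_fst.comp measurable_fst)))
    have h2 : Measurable fun p : ((ℕ → ℕ) × T × Set.Icc 0 β) × Obs dX dW =>
        γ p.1.2.1 p.2.1 := hγ.comp
      (((measurable_fst.comp (measurable_snd.comp measurable_fst))).prodMk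
        (measurable_fst.comp measurable_snd))
    have h3 : Measurable fun p : ((ℕ → ℕ) × T × Set.Icc 0 β) × Obs dX dW =>
        (p.1.2.2 : ℝ) :=
      measurable_subtype_coe.comp (measurable_snd.comp (measurable_snd.comp measurable_fst))
    have hc : Measurable fun v : E dY => v j := by fun_prop
    exact h3.mul ((hc.comp h1).mul (hc.comp h2))
  have hw : Measurable (Function.uncurry fun i z => clipWeight (φ i z)) :=
    continuous_clipWeight.measurable.comp hφ
  have hmain := measure_exists_prod_ge_le P n hw (fun _ _ => half_le_clipWeight _)
    (fun _ _ => clipWeight_le _) (Real.exp_pos τ)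
    (N := A * ((n : ℝ) * (n + 1)) ^ V) fun x => by
      obtain ⟨k, hk, h, hh⟩ := exists_cover_clipWeight hcov hA hβ1 hn x
      exact ⟨k, hk, h, fun i => hh (ϑ i.1) (γ i.2.1) ⟨_, rfl⟩ i.2.2 i.2.2.2⟩
  refine le_trans (measure_mono ?_) hmain
  rintro x ⟨θ, g, ⟨t, rfl⟩, s, hs, hmean, hτ⟩
  obtain ⟨a, ha⟩ : ∃ a, f a = θ := hfr.ge θ.2
  have hθ : ϑ a = θ := Subtype.ext ha
  refine ⟨(a, t, ⟨s, hs⟩), ?_, ?_⟩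
  · have hae : (fun z => clipWeight (φ (a, t, ⟨s, hs⟩) z)) =ᵐ[P]
        fun z => 1 - s * weightedMoment m θ (γ t) j z := by
      filter_upwards [hbd θ (γ t) ⟨t, rfl⟩] with z hz
      have : φ (a, t, ⟨s, hs⟩) z = s * weightedMoment m θ (γ t) j z := by
        simp only [φ, hθ]
      rw [this, clipWeight_of_abs_le]
      rw [abs_mul, abs_of_nonneg hs.1]
      exact (mul_le_mul hs.2 hz (abs_nonneg _) (hs.1.trans hs.2)).trans hβY
    have hmeas : Measurable (weightedMoment (dX := dX) m θ (γ t) j) := by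
      have hc : Measurable fun v : E dY => v j := by fun_prop
      have h1 : Measurable fun z : Obs dX dW => m (z.2, θ) :=
        hm.comp (measurable_snd.prodMk measurable_const)
      have h2 : Measurable fun z : Obs dX dW => γ t z.1 :=
        hγ.comp (measurable_const.prodMk measurable_fst)
      exact (hc.comp h1).mul (hc.comp h2)
    have hint : Integrable (weightedMoment m θ (γ t) j) P :=
      Integrable.of_bound hmeas.aestronglyMeasurable Ybar (hbd θ (γ t) ⟨t, rfl⟩)
    rw [integral_congr_ae hae, integral_sub (integrable_const _) (hint.const_mul s),
      integral_const_mul]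
    simp only [integral_const, probReal_univ, smul_eq_mul, mul_one]
    linarith [mul_nonneg hs.1 hmean]
  · refine (Real.exp_le_exp.2 hτ).trans ?_
    rw [Real.exp_sum]
    refine Finset.prod_le_prod (fun i _ => (Real.exp_pos _).le) fun i _ => ?_
    have : φ (a, t, ⟨s, hs⟩) (x i) = s * weightedMoment m θ (γ t) j (x i) := by
      simp only [φ, hθ]
    rw [this]
    exact exp_le_clipWeight _

/-- With the scale of the exponent chosen according to the covering exponent, the bound is of
order `1 / n`. -/
theorem covering_div_exp_le {A V : ℝ} (hA : 0 < A) (hV : 0 < V) {n : ℕ} (hn : 2 ≤ n) :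
    4 * Real.exp 5 * (A * ((n : ℝ) * (n + 1)) ^ V) / Real.exp ((2 * V + 1) * Real.log n) ≤
      4 * Real.exp 5 * A * 2 ^ V / n := by
  have hn0 : (0 : ℝ) < n := by exact_mod_cast (by omega : 0 < n)
  have hn1 : (1 : ℝ) ≤ n := by exact_mod_cast (by omega : 1 ≤ n)
  have h1 : ((n : ℝ) * (n + 1)) ^ V ≤ 2 ^ V * (n : ℝ) ^ (2 * V) := by
    have h2 : (n : ℝ) * (n + 1) ≤ 2 * (n : ℝ) ^ (2 : ℝ) := by
      rw [Real.rpow_two]; nlinarith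
    calc ((n : ℝ) * (n + 1)) ^ V ≤ (2 * (n : ℝ) ^ (2 : ℝ)) ^ V :=
          Real.rpow_le_rpow (by positivity) h2 hV.le
      _ = 2 ^ V * (n : ℝ) ^ (2 * V) := by
          rw [Real.mul_rpow (by norm_num) (by positivity), ← Real.rpow_mul hn0.le]
  have h3 : Real.exp ((2 * V + 1) * Real.log n) = (n : ℝ) ^ (2 * V) * n := by
    rw [mul_comm, ← Real.rpow_def_of_pos hn0, Real.rpow_add hn0, Real.rpow_one]
  rw [h3, div_le_div_iff₀ (by positivity) hn0]
  calc 4 * Real.exp 5 * (A * ((n : ℝ) * (n + 1)) ^ V) * n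
      ≤ 4 * Real.exp 5 * (A * (2 ^ V * (n : ℝ) ^ (2 * V))) * n := by gcongr
    _ = _ := by ring

end Model

/-! ### Inner probabilities -/

theorem innerProb_le_one {Ω : Type*} [MeasurableSpace Ω] (μ : Measure Ω) [IsProbabilityMeasure μ]
    (s : Set Ω) : innerProb μ s ≤ 1 :=
  iSup_le fun _ => iSup_le fun _ => iSup_le fun _ => prob_le_one

/-- Inclusion-exclusion for measurable subsets of s and t; deleting a measurable hull of the
exceptional set from their intersection leaves a measurable subset of u. -/
theorem innerProb_add_le {Ω : Type*} [MeasurableSpace Ω] (μ : Measure Ω) [IsProbabilityMeasure μ]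
    {s t u : Set Ω} {p : ℝ≥0∞} (h : μ ((s ∩ t) \ u) ≤ p) :
    innerProb μ s + innerProb μ t ≤ innerProb μ u + (1 + p) := by
  have hI : ∀ r : Set Ω, innerProb μ r = ⨆ (A : Set Ω) (_ : MeasurableSet A ∧ A ⊆ r), μ A :=
    fun r => by simp only [innerProb, iSup_and]
  rw [hI s, hI t]
  refine ENNReal.biSup_add_biSup_le' ⟨∅, .empty, Set.empty_subset _⟩
    ⟨∅, .empty, Set.empty_subset _⟩ fun A hA B hB => ?_
  let N := toMeasurable μ ((s ∩ t) \ u)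
  have hN : MeasurableSet N := measurableSet_toMeasurable _ _
  have hsub : (A ∩ B) \ N ⊆ u := by
    rintro ω ⟨⟨hωA, hωB⟩, hωN⟩
    by_contra hωu
    exact hωN (subset_toMeasurable _ _ ⟨⟨hA.2 hωA, hB.2 hωB⟩, hωu⟩)
  have hu : μ ((A ∩ B) \ N) ≤ innerProb μ u :=
    le_iSup_of_le _ (le_iSup_of_le ((hA.1.inter hB.1).diff hN) (le_iSup_of_le hsub le_rfl))
  calc μ A + μ B = μ (A ∪ B) + μ (A ∩ B) := (measure_union_add_inter A hB.1).symm
    _ ≤ 1 + (μ ((A ∩ B) \ N) + μ N) := by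
        refine add_le_add prob_le_one ?_
        refine (measure_mono ?_).trans (measure_union_le _ _)
        intro ω hω
        by_cases h : ω ∈ N
        · exact Or.inr h
        · exact Or.inl ⟨hω, h⟩
    _ ≤ 1 + (innerProb μ u + p) := by
        rw [measure_toMeasurable]
        gcongr
    _ = _ := by ring

/-- Uniform convergence of inner probabilities passes to events that contain the intersection of
two such events up to sets of uniformly vanishing outer measure. -/
theorem UniformlyWPA1.of_inter_diff_le {Ω Z : Type*} [MeasurableSpace Ω] [MeasurableSpace Z]
    {Ps : Set (Measure Z)} {Pr : Measure Z → Measure Ω}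
    (hPr : ∀ P ∈ Ps, IsProbabilityMeasure (Pr P)) {s t u : Measure Z → ℕ → Set Ω}
    (hs : UniformlyWPA1 Ps Pr s) (ht : UniformlyWPA1 Ps Pr t) {p : ℕ → ℝ≥0∞}
    (hp : Tendsto p atTop (𝓝 0))
    (h : ∀ᶠ n in atTop, ∀ P ∈ Ps, Pr P ((s P n ∩ t P n) \ u P n) ≤ p n) :
    UniformlyWPA1 Ps Pr u := by
  -- Over an empty class the infimum is `⊤`, which does not tend to 1.
  have hne : Ps.Nonempty := by
    by_contra hcon
    rw [Set.not_nonempty_iff_eq_empty] at hcon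
    subst hcon
    simp only [UniformlyWPA1, Set.mem_empty_iff_false, iInf_false, iInf_top] at hs
    exact absurd (tendsto_nhds_unique hs tendsto_const_nhds) (by simp)
  obtain ⟨P₀, hP₀⟩ := hne
  unfold UniformlyWPA1 at hs ht ⊢
  have hlim := ENNReal.Tendsto.sub (hs.add ht) ((tendsto_const_nhds (x := (1 : ℝ≥0∞))).add hp)
    (Or.inl (by simp))
  rw [add_zero, ENNReal.add_sub_cancel_right (by simp)] at hlim
  refine tendsto_of_tendsto_of_tendsto_of_le_of_le' hlim tendsto_const_nhds ?_ ?_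
  · filter_upwards [h] with n hn
    refine le_iInf₂ fun P hP => ?_
    have := hPr P hP
    rw [tsub_le_iff_right]
    exact (add_le_add (iInf₂_le P hP) (iInf₂_le P hP)).trans (innerProb_add_le _ (hn P hP))
  · refine Eventually.of_forall fun n => (iInf₂_le P₀ hP₀).trans ?_
    have := hPr P₀ hP₀
    exact innerProb_le_one _ _

end KSCoverage

/-! ### Uniform coverage -/

open KSCoverage in
theorem theorem1 (V Ybar : ℝ) (hV : 0 < V) (hYbar : 0 ≤ Ybar) :
    -- the constant depends on nothing but `V` and `Ybar`
    ∃ K₀ : ℝ, ∀ (dX dW d dY : ℕ)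
      -- parameter space, moment function and class of instruments
      (Θ : Set (E d)) (_ : AnalyticSet Θ)
      (m : E dW × Θ → E dY) (_ : Measurable m)
      (G : Set (E dX → E dY)) (_ : Permissible G)
      -- the class of distributions of one observation
      (Ps : Set (Measure (Obs dX dW))) (_ : ∀ P ∈ Ps, IsProbabilityMeasure P)
      -- the data: iid with distribution `P` under `Pr P`
      (Ω : Type*) (_ : MeasurableSpace Ω) (Pr : Measure (Obs dX dW) → Measure Ω)
      (Z : ℕ → Ω → Obs dX dW) (_ : ∀ i, Measurable (Z i))
      (_ : ∀ P ∈ Ps, iIndepFun Z (Pr P)) (_ : ∀ P ∈ Ps, ∀ i, (Pr P).map (Z i) = P)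
      -- the instruments are nonnegative
      (_ : ∀ P ∈ Ps, ∀ g ∈ G, ∀ j, ∀ᵐ z ∂P, 0 ≤ g z.1 j)
      -- polynomial uniform covering numbers
      (A : ℝ) (_ : 0 < A)
      (_ : ∀ j, HasPolynomialCovering (classOne (dX := dX) m G Ybar j) A V ∧
        HasPolynomialCovering (classTwo (dX := dX) m G Ybar j) A V)
      -- bounded moments
      (_ : ∀ P ∈ Ps, ∀ θ : Θ, ∀ g ∈ G, ∀ j, ∀ᵐ z ∂P, |weightedMoment m θ g j z| ≤ Ybar)
      -- the function `S`
      (S : E dY → ℝ≥0) (KS₁ KS₂ : ℝ) (_ : SCondition S KS₁ KS₂)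
      -- truncation points, lower bounds for them, and critical values, all data dependent
      (σ a c : ℕ → Ω → ℝ)
      (_ : ∃ C : ℝ, ∀ P ∈ Ps, ∀ n, ∀ᵐ ω ∂(Pr P), σ n ω ≤ C)
      (_ : ∀ P ∈ Ps, ∀ n : ℕ, 2 ≤ n → ∀ᵐ ω ∂(Pr P),
        a n ω ≤ σ n ω * Real.sqrt (n / Real.log n))
      (K : ℝ) (_ : K₀ < K) (_ : K₀ < K * KS₁)
      (_ : UniformlyWPA1 Ps Pr fun _ n => {ω | K ≤ a n ω})
      (_ : UniformlyWPA1 Ps Pr fun _ n => {ω | K ≤ c n ω}),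
      UniformlyWPA1 Ps Pr fun P n =>
        {ω | identifiedSet m P ⊆ confidenceRegion m G S n (fun i => Z i ω) (σ n ω) (c n ω)} := by
  have hM : (1 : ℝ) ≤ max Ybar 1 := le_max_right _ _
  -- Scales up to β keep |sf| ≤ 1/2 almost surely; the maximum with 1 also gives β ≤ 1/2.
  obtain ⟨β, hβ⟩ : ∃ β, β = 1 / (2 * max Ybar 1) := ⟨_, rfl⟩
  have hβ0 : 0 < β := by rw [hβ]; positivity
  have hβ2 : β ≤ 1 / 2 := by
    rw [hβ]
    exact one_div_le_one_div_of_le (by norm_num) (by linarith)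
  have hβY : β * Ybar ≤ 1 / 2 := by
    rw [hβ, one_div_mul_eq_div, div_le_iff₀ (by positivity)]
    linarith [le_max_left Ybar 1]
  -- Chosen so that βκn/4 with κ = K₀² log n / n equals (2V+1) log n: 2V pays for the cover, and the
  -- extra 1 leaves a bound of order 1/n.
  obtain ⟨K₀, hK₀⟩ : ∃ K₀, K₀ = Real.sqrt (4 * (2 * V + 1) / β) := ⟨_, rfl⟩
  have hK₀0 : 0 < K₀ := by rw [hK₀]; exact Real.sqrt_pos.2 (by positivity)
  have hK₀2 : K₀ ^ 2 = 4 * (2 * V + 1) / β := by rw [hK₀, Real.sq_sqrt (by positivity)]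
  refine ⟨K₀, ?_⟩
  intro dX dW d dY Θ hΘ m hm G hG Ps hPs Ω _ Pr Z hZ hindep hlaw hg0 A hA hcov hbd S KS₁ KS₂ hS
    σ a c _ haσ K hK hKS ha hc
  have hPr : ∀ P ∈ Ps, IsProbabilityMeasure (Pr P) := fun P hP => by
    have := hPs P hP
    rw [← hlaw P hP 0] at this
    exact Measure.isProbabilityMeasure_of_map (Z 0)
  let C : ℝ := 4 * Real.exp 5 * A * 2 ^ V
  have hp : Tendsto (fun n : ℕ => (dY : ℝ≥0∞) * ENNReal.ofReal (C / n)) atTop (𝓝 0) := by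
    have h1 : Tendsto (fun n : ℕ => ENNReal.ofReal (C / n)) atTop (𝓝 0) := by
      have := ENNReal.tendsto_ofReal (tendsto_const_div_atTop_nhds_zero_nat C)
      rwa [ENNReal.ofReal_zero] at this
    have := ENNReal.Tendsto.const_mul (a := (dY : ℝ≥0∞)) h1 (Or.inr (by simp))
    rwa [mul_zero] at this
  have hsmall : ∀ᶠ n : ℕ in atTop, K₀ ^ 2 * (Real.log n / n) ≤ 1 / 2 := by
    have h1 : Tendsto (fun n : ℕ => Real.log n / n) atTop (𝓝 0) :=
      (Real.isLittleO_log_id_atTop.tendsto_div_nhds_zero).comp tendsto_natCast_atTop_atTop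
    have h2 := h1.const_mul (K₀ ^ 2)
    rw [mul_zero] at h2
    exact (h2.eventually (gt_mem_nhds (by norm_num : (0 : ℝ) < 1 / 2))).mono fun n hn => hn.le
  refine ha.of_inter_diff_le hPr hc hp ?_
  filter_upwards [hsmall, eventually_ge_atTop 2] with n hn hn2 P hP
  have hPprob := hPs P hP
  have hPrprob := hPr P hP
  have hn0 : (0 : ℝ) < n := by exact_mod_cast (by omega : 0 < n)
  have hlog : 0 < Real.log n := Real.log_pos (by exact_mod_cast (by omega : 1 < n))
  let X : Ω → Fin n → Obs dX dW := fun ω i => Z i ω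
  have hX : Measurable X := measurable_pi_iff.2 fun i => hZ i
  have hXlaw : (Pr P).map X = Measure.pi fun _ => P := by
    have h1 := (iIndepFun_iff_map_fun_eq_pi_map fun i : Fin n => (hZ i).aemeasurable).1
      ((hindep P hP).precomp Fin.val_injective)
    rw [h1]
    exact congrArg _ (funext fun i => hlaw P hP i)
  let B : Fin dY → Set (Fin n → Obs dX dW) := fun j => {x | ∃ θ : Θ, ∃ g ∈ G,
    ∃ s ∈ Set.Icc 0 β, 0 ≤ ∫ z, weightedMoment m θ g j z ∂P ∧
      (2 * V + 1) * Real.log n ≤ ∑ i, (-(s * weightedMoment m θ g j (x i)) -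
        (s * weightedMoment m θ g j (x i)) ^ 2)}
  have hB : ∀ j, Pr P (X ⁻¹' B j) ≤ ENNReal.ofReal (C / n) := fun j =>
    calc Pr P (X ⁻¹' B j) ≤ (Pr P).map X (B j) := Measure.le_map_apply hX.aemeasurable _
      _ ≤ _ := by
        rw [hXlaw]
        exact measure_exists_scale_le hΘ hm hG (hcov j).1 hA
          (fun θ g hg => hbd P hP θ g hg j) (by linarith) hβY hn2 _
      _ ≤ ENNReal.ofReal (C / n) := ENNReal.ofReal_le_ofReal (covering_div_exp_le hA hV hn2)
  have hN : Pr P {ω | ¬ a n ω ≤ σ n ω * Real.sqrt (n / Real.log n)} = 0 := haσ P hP n hn2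
  have hsub : ({ω | K ≤ a n ω} ∩ {ω | K ≤ c n ω}) \ {ω | identifiedSet m P ⊆
      confidenceRegion m G S n (fun i => Z i ω) (σ n ω) (c n ω)} ⊆
      {ω | ¬ a n ω ≤ σ n ω * Real.sqrt (n / Real.log n)} ∪ ⋃ j, X ⁻¹' B j := by
    rintro ω ⟨⟨hωa, hωc⟩, hω⟩
    by_cases hωσ : a n ω ≤ σ n ω * Real.sqrt (n / Real.log n)
    · obtain ⟨θ, hθ, hθC⟩ := Set.not_subset.1 hω
      obtain ⟨g, hg, j, h1, h2⟩ := exists_sampleMean_le_of_notMem hS hn2 hK₀0 hK hKS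
        (le_trans hωa hωσ) hωc hθC
      obtain ⟨s, hs, hsum⟩ := exists_scale_of_sampleMean_le (by omega) _ _
        (by positivity) hn hβ0 hβ2 h1 h2
      refine Or.inr (Set.mem_iUnion.2 ⟨j, θ, g, hg, s, hs, ?_, ?_⟩)
      · obtain ⟨T, _, _, γ, hγ, rfl⟩ := hG
        obtain ⟨t, rfl⟩ := hg
        have hγt : Measurable (γ t) := hγ.comp measurable_prodMk_left
        refine integral_weightedMoment_nonneg hθ hγt j (hg0 P hP _ ⟨t, rfl⟩ j) ?_
        refine Integrable.of_bound ?_ Ybar (hbd P hP θ _ ⟨t, rfl⟩ j)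
        have hγj : Measurable fun z : Obs dX dW => γ t z.1 j := by fun_prop
        exact (hθ j).1.aestronglyMeasurable.mul hγj.aestronglyMeasurable
      · rw [Finset.sum_range] at hsum
        refine le_of_eq_of_le ?_ hsum
        rw [hK₀2]
        field_simp
    · exact Or.inl hωσ
  calc _ ≤ Pr P ({ω | ¬ a n ω ≤ σ n ω * Real.sqrt (n / Real.log n)} ∪ ⋃ j, X ⁻¹' B j) :=
        measure_mono hsub
    _ ≤ 0 + ∑ j, Pr P (X ⁻¹' B j) := by
        refine (measure_union_le _ _).trans ?_
        rw [hN]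
        gcongr
        exact measure_iUnion_fintype_le _ _
    _ ≤ 0 + ∑ _j : Fin dY, ENNReal.ofReal (C / n) := by gcongr with j; exact hB j
    _ = _ := by simp
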